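/- All quantum systems are finite dimensional. For a state $\varrho_{RA}$ on $\mathscr H_R\otimes\mathscr H_A$ let $I^{R:A}(\varrho_{RA}):=S(\varrho_R)+S(\varrho_A)-S(\varrho_{RA})$ be its quantum mutual information, where $S(\sigma):=-\mathrm{Tr}\,\sigma\log_2\sigma$ is the von Neumann entropy and $\varrho_R,\varrho_A$ are the reduced states. For an isometry $V_A:\mathscr H_A\to\mathscr H_B\otimes\mathscr H_E$ put $\varsigma_{RBE}:=(\mathbb 1_R\otimes V_A)\varrho_{RA}(\mathbb 1_R\otimes V_A^\dagger)$, and let $I^{R:B}(\varsigma_{RBE})$ and $I^{R:E}(\varsigma_{RBE})$ be the mutual informations of the reduced states $\varsigma_{RB}$ and $\varsigma_{RE}$. For $\varepsilon\in[0,\infty]$ let $\mathcal V_\varepsilon(\varrho_{RA})$ be the set of all isometries $V_A:\mathscr H_A\to\mathscr H_B\otimes\mathscr H_E$, with $\mathscr H_B,\mathscr H_E$ arbitrary finite-dimensional Hilbert spaces, such that $I^{R:E}(\varsigma_{RBE})\le\varepsilon$ and $I^{R:E}(\varsigma_{RBE})\le I^{R:B}(\varsigma_{RBE})$. Define \[ \Xi_A(\varrho_{RA};\varepsilon):=\inf_{V_A\in\mathcal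 V_\varepsilon(\varrho_{RA})}I^{R:B}(\varsigma_{RBE}),\qquad \Xi_A(\varrho_{RA}):=\Xi_A(\varrho_{RA};\infty). \] Then, for every bipartite state $\varrho_{RA}$, \[ \Xi_A(\varrho_{RA})\le\frac{I^{R:A}(\varrho_{RA})}{2}; \] more precisely, some $V_A\in\mathcal V_\infty(\varrho_{RA})$ satisfies $I^{R:B}(\varsigma_{RBE})\le I^{R:A}(\varrho_{RA})/2$. -/

import Mathlib

open scoped Matrix Kronecker ENNReal ComplexOrder

namespace PQD

/-- A state (density matrix) of a finite-dimensional quantum system whose Hilbert space is `ℂⁿ`,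
with an orthonormal basis indexed by the finite type `n`. States of a composite system are indexed
by the product of the index types. -/
structure State (n : Type*) [Fintype n] where
  /-- the matrix of the state -/
  mat : Matrix n n ℂ
  posSemidef : mat.PosSemidef
  trace_eq_one : mat.trace = 1

/-- An isometry `ℂᵃ → ℂᵇ`, as a matrix `V` with `Vᴴ V = 1`. -/
structure Isom (a b : Type*) [Fintype a] [Fintype b] [DecidableEq a] where
  /-- the matrix of the isometry -/
  mat : Matrix b a ℂ
  isometry : matᴴ * mat = 1

section

variable {n m k : Type*} [Fintype n] [Fintype m] [Fintype k]

/-- The von Neumann entropy `S(σ) = - Tr σ log₂ σ = - ∑ᵢ λᵢ log₂ λᵢ`, where the `λᵢ` are the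
eigenvalues of `σ` with multiplicity (and `0 log₂ 0 = 0`). -/
noncomputable def entropy [DecidableEq n] (σ : State n) : ℝ :=
  -∑ i, σ.posSemidef.isHermitian.eigenvalues i *
    Real.logb 2 (σ.posSemidef.isHermitian.eigenvalues i)

/-- The partial trace over `k` of a state on `m`, when `e` identifies the indices of `m` with
those of `n × k`. -/
def State.marginal (e : n × k ≃ m) (σ : State m) : State n where
  mat := Matrix.of fun i j => ∑ x, σ.mat (e (i, x)) (e (j, x))
  posSemidef := by
    have h : (Matrix.of fun i j => ∑ x, σ.mat (e (i, x)) (e (j, x))) =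
        ∑ x : k, σ.mat.submatrix (fun i => e (i, x)) (fun i => e (i, x)) := by
      ext i j
      simp [Matrix.sum_apply]
    rw [h]
    exact Matrix.posSemidef_sum _ fun x _ => σ.posSemidef.submatrix _
  trace_eq_one := by
    have h := σ.trace_eq_one
    simp only [Matrix.trace, Matrix.diag, Matrix.of_apply] at h ⊢
    rw [← h, ← Fintype.sum_prod_type' (f := fun i x => σ.mat (e (i, x)) (e (i, x)))]
    exact Equiv.sum_comp e fun y => σ.mat y y

/-- The state `V σ Vᴴ` obtained by applying an isometry `V` to the state `σ`. -/
def State.conj [DecidableEq n] (V : Isom n m) (σ : State n) : State m where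
  mat := V.mat * σ.mat * V.matᴴ
  posSemidef := σ.posSemidef.mul_mul_conjTranspose_same _
  trace_eq_one := by
    rw [Matrix.trace_mul_comm, ← Matrix.mul_assoc, V.isometry, Matrix.one_mul, σ.trace_eq_one]

end

section

variable {R A B E : Type*} [Fintype R] [Fintype A] [Fintype B] [Fintype E]

/-- The reduced state of the first system of a bipartite state. -/
def State.fst (ρ : State (R × A)) : State R := ρ.marginal (Equiv.refl (R × A))

/-- The reduced state of the second system of a bipartite state. -/
def State.snd (ρ : State (R × A)) : State A := ρ.marginal (Equiv.prodComm A R)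

/-- The reduced state on `RB` of a state on `RBE` (partial trace over `E`). -/
def State.tracedE (ς : State (R × (B × E))) : State (R × B) :=
  ς.marginal (Equiv.prodAssoc R B E)

/-- The reduced state on `RE` of a state on `RBE` (partial trace over `B`). -/
def State.tracedB (ς : State (R × (B × E))) : State (R × E) :=
  ς.marginal ((Equiv.prodAssoc R E B).trans ((Equiv.refl R).prodCongr (Equiv.prodComm E B)))

variable [DecidableEq R] [DecidableEq A] [DecidableEq B] [DecidableEq E]

/-- The quantum mutual information `I^{R:A}(ρ) = S(ρ_R) + S(ρ_A) - S(ρ_{RA})`, in bits. -/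
noncomputable def mutualInfo (ρ : State (R × A)) : ℝ :=
  entropy ρ.fst + entropy ρ.snd - entropy ρ

/-- The isometry `1_R ⊗ V`. -/
def Isom.idTensor (R : Type*) [Fintype R] [DecidableEq R] (V : Isom A B) :
    Isom (R × A) (R × B) where
  mat := (1 : Matrix R R ℂ) ⊗ₖ V.mat
  isometry := by
    rw [Matrix.conjTranspose_kronecker, ← Matrix.mul_kronecker_mul, V.isometry]
    simp

/-- The state `ς_{RBE} = (1_R ⊗ V) ρ_{RA} (1_R ⊗ V)ᴴ`. -/
def output (ρ : State (R × A)) (V : Isom A (B × E)) : State (R × (B × E)) :=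
  ρ.conj (V.idTensor R)

/-- The quantity `I^{R:B}(ς_{RBE})`: the correlations with `R` kept in the output `B`. -/
noncomputable def infoB (ρ : State (R × A)) (V : Isom A (B × E)) : ℝ :=
  mutualInfo (output ρ V).tracedE

/-- The quantity `I^{R:E}(ς_{RBE})`: the correlations with `R` sent to the environment `E`. -/
noncomputable def infoE (ρ : State (R × A)) (V : Isom A (B × E)) : ℝ :=
  mutualInfo (output ρ V).tracedB

/-- The set `𝒱_ε(ρ_{RA})` of isometries `V : A → BE`, with `B` of dimension `dB` and `E` of
dimension `dE`, such that `I^{R:E}(ς_{RBE}) ≤ ε` and `I^{R:E}(ς_{RBE}) ≤ I^{R:B}(ς_{RBE})`. -/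
def admissible (ρ : State (R × A)) (ε : ℝ≥0∞) (dB dE : ℕ) :
    Set (Isom A (Fin dB × Fin dE)) :=
  {V | (infoE ρ V : EReal) ≤ (ε : EReal) ∧ infoE ρ V ≤ infoB ρ V}

/-- The `ε`-ineliminable information `Ξ_A(ρ_{RA}; ε)`: the infimum of `I^{R:B}(ς_{RBE})` over all
`V ∈ 𝒱_ε(ρ_{RA})`, the output system `B` and the environment `E` being arbitrary
finite-dimensional systems. It is taken in the extended reals, so that no convention on infima of
empty or unbounded sets of reals is involved. -/
noncomputable def ineliminable (ρ : State (R × A)) (ε : ℝ≥0∞) : EReal :=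
  ⨅ (dB : ℕ) (dE : ℕ) (V ∈ admissible ρ ε dB dE), (infoB ρ V : EReal)

end

end PQD

/-! The witness sends the input, in equal coherent superposition, to `B` or to `E`, the other system
receiving a flag `e` orthogonal to all inputs. Exchanging `B` and `E` fixes this isometry, so
I^{R:E} = I^{R:B} and admissibility is automatic. Tracing out `E` gives an erasure channel of
probability 1/2: ς_RB = ½ρ_RA ⊕ ½ρ_R⊗|e⟩⟨e|. Hence S(RB) = 1 + (S(RA) + S(R))/2 and S(B) = 1 +
S(A)/2, with S(R) unchanged; the constants cancel and I^{R:B} is exactly half of I^{R:A}. The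
entropies come from `entropy_of_blocks`, the block form from `tracedE_symmetricErasure_apply`. -/

open Polynomial in
theorem PQD.entropy_eq_of_charpoly {n ι : Type*} [Fintype n] [DecidableEq n] [Fintype ι]
    (σ : PQD.State n) (d : ι → ℝ) (h : σ.mat.charpoly = ∏ i, (X - C (d i : ℂ))) :
    PQD.entropy σ = -∑ i, d i * Real.logb 2 (d i) := by
  have h₁ := σ.posSemidef.isHermitian.roots_charpoly_eq_eigenvalues
  have h₂ : (∏ i, (X - C (d i : ℂ))).roots = Finset.univ.val.map fun i => (d i : ℂ) := by
    have h₃ := roots_multiset_prod_X_sub_C (Finset.univ.val.map fun i => (d i : ℂ))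
    rwa [Multiset.map_map] at h₃
  rw [h, h₂] at h₁
  -- Equality of root multisets suffices: no matching between the two indexings of the spectrum is
  -- needed.
  have h₄ := congrArg
    (fun s => (s.map fun z : ℂ => z.re * Real.logb 2 z.re).sum) h₁
  simp only [Multiset.map_map, Function.comp_def, Complex.ofReal_re] at h₄
  rw [PQD.entropy]
  exact congrArg Neg.neg h₄.symm

open Polynomial in
theorem Matrix.IsHermitian.charpoly_real_smul {n : Type*} [Fintype n] [DecidableEq n]
    {M : Matrix n n ℂ} (hM : M.IsHermitian) (c : ℝ) :
    ((c : ℂ) • M).charpoly = ∏ i, (X - C ((c * hM.eigenvalues i : ℝ) : ℂ)) := by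
  have h := hM.spectral_theorem
  rw [Unitary.conjStarAlgAut_apply] at h
  have h' : (c : ℂ) • M = (hM.eigenvectorUnitary : Matrix n n ℂ) *
      (Matrix.diagonal fun i => ((c * hM.eigenvalues i : ℝ) : ℂ)) *
      star (hM.eigenvectorUnitary : Matrix n n ℂ) := by
    conv_lhs => rw [h]
    rw [← Matrix.smul_mul, ← Matrix.mul_smul, ← Matrix.diagonal_smul]
    congr 3
    ext i
    simp
  rw [h', Matrix.mul_assoc, Matrix.charpoly_mul_comm, Matrix.mul_assoc,
    Unitary.coe_star_mul_self, Matrix.mul_one, Matrix.charpoly_diagonal]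

theorem PQD.sum_eigenvalues_eq_one {n : Type*} [Fintype n] [DecidableEq n] (σ : PQD.State n) :
    ∑ i, σ.posSemidef.isHermitian.eigenvalues i = 1 := by
  have h := σ.posSemidef.isHermitian.trace_eq_sum_eigenvalues
  rw [σ.trace_eq_one] at h
  exact Complex.ofReal_injective (by simpa using h.symm)

/-- Each eigenvalue contributes its half-weight times log₂ ½ = -1; as they sum to 1, this gives the
term -1/2. -/
theorem PQD.sum_half_eigenvalues_mul_logb {n : Type*} [Fintype n] [DecidableEq n] (σ : PQD.State n) :
    ∑ i, (1 / 2 * σ.posSemidef.isHermitian.eigenvalues i) *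
      Real.logb 2 (1 / 2 * σ.posSemidef.isHermitian.eigenvalues i) =
      -(1 / 2) - PQD.entropy σ / 2 := by
  have h : ∀ x : ℝ, 1 / 2 * x * Real.logb 2 (1 / 2 * x) =
      1 / 2 * (x * Real.logb 2 x) - 1 / 2 * x := by
    intro x
    rcases eq_or_ne x 0 with rfl | hx
    · simp
    · rw [Real.logb_mul (by norm_num) hx, one_div, Real.logb_inv,
        Real.logb_self_eq_one (by norm_num)]
      ring
  simp only [h, Finset.sum_sub_distrib, ← Finset.mul_sum, PQD.sum_eigenvalues_eq_one, PQD.entropy]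
  ring

/-- The entropy of an equal mixture of two states with orthogonal supports. -/
theorem PQD.entropy_of_blocks {n p q : Type*} [Fintype n] [Fintype p] [Fintype q]
    [DecidableEq n] [DecidableEq p] [DecidableEq q] (σ : PQD.State n) (τ : PQD.State p)
    (ω : PQD.State q) (e : p ⊕ q ≃ n)
    (h : σ.mat.submatrix e e =
      Matrix.fromBlocks (((1 / 2 : ℝ) : ℂ) • τ.mat) 0 0 (((1 / 2 : ℝ) : ℂ) • ω.mat)) :
    PQD.entropy σ = 1 + (PQD.entropy τ + PQD.entropy ω) / 2 := by
  -- Relabelling the basis keeps the characteristic polynomial, which factors over the blocks.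
  have hc : σ.mat.charpoly = (σ.mat.submatrix e e).charpoly :=
    (Matrix.charpoly_reindex e.symm σ.mat).symm
  rw [h, Matrix.charpoly_fromBlocks_zero₁₂,
    τ.posSemidef.isHermitian.charpoly_real_smul, ω.posSemidef.isHermitian.charpoly_real_smul] at hc
  rw [PQD.entropy_eq_of_charpoly σ (Sum.elim
    (fun i => 1 / 2 * τ.posSemidef.isHermitian.eigenvalues i)
    (fun i => 1 / 2 * ω.posSemidef.isHermitian.eigenvalues i))
    (by rw [hc, Fintype.prod_sum_type]; rfl), Fintype.sum_sum_type]
  simp only [Sum.elim_inl, Sum.elim_inr, PQD.sum_half_eigenvalues_mul_logb]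
  ring

theorem PQD.entropy_unit (σ : PQD.State Unit) : PQD.entropy σ = 0 := by
  have h := PQD.sum_eigenvalues_eq_one σ
  simp only [Fintype.sum_unique] at h
  simp [PQD.entropy, h]

namespace PQD

theorem State.ext_mat {n : Type*} [Fintype n] {σ τ : State n} (h : σ.mat = τ.mat) : σ = τ := by
  cases σ; cases τ; cases h; rfl

/-- The trivial state of a one-dimensional system. -/
def State.unit : State Unit where
  mat := 1
  posSemidef := Matrix.PosSemidef.one
  trace_eq_one := by simp

variable {R A B : Type*} [Fintype R] [Fintype A] [Fintype B]
  [DecidableEq R] [DecidableEq A] [DecidableEq B]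

/-- The isometry `|ψ⟩ ↦ (|ψ⟩|e⟩ + |e⟩|ψ⟩) / √2` into two copies of `ℂᴬ ⊕ ℂ`, where the unit vector
`|e⟩` spans the second summand. -/
noncomputable def symmetricErasure (g : A ⊕ Unit ≃ B) : Isom A (B × B) where
  mat := Matrix.of fun x a => ((√2)⁻¹ : ℂ) *
    ((if x = (g (.inl a), g (.inr ())) then 1 else 0) +
      (if x = (g (.inr ()), g (.inl a)) then 1 else 0))
  isometry := by
    have hs : ((√2)⁻¹ : ℂ) * ((√2)⁻¹ : ℂ) = 1 / 2 := by
      rw [← mul_inv, ← Complex.ofReal_mul, Real.mul_self_sqrt (by norm_num)]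
      norm_num
    ext a a'
    simp only [Matrix.mul_apply, Matrix.conjTranspose_apply, Matrix.of_apply, star_mul',
      star_add, apply_ite (star : ℂ → ℂ), star_one, star_zero]
    simp only [RCLike.star_def, map_inv₀, Complex.conj_ofReal,
      mul_add, add_mul, Finset.sum_add_distrib, mul_ite, mul_one, mul_zero,
      Finset.sum_ite_eq', Finset.mem_univ, if_true]
    by_cases h : a = a'
    · subst h; simp [hs]; norm_num
    · simp [h, Ne.symm h]

theorem symmetricErasure_swap (g : A ⊕ Unit ≃ B) (b c : B) (a : A) :
    (symmetricErasure g).mat (b, c) a = (symmetricErasure g).mat (c, b) a := by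
  simp only [symmetricErasure, Matrix.of_apply, Prod.mk.injEq]
  rw [add_comm]
  simp only [and_comm]

theorem output_apply {E F : Type*} [Fintype E] [Fintype F] (ρ : State (R × A))
    (V : Isom A (E × F)) (r r' : R) (x x' : E × F) :
    (output ρ V).mat (r, x) (r', x') =
      ∑ a, ∑ a', V.mat x a * ρ.mat (r, a) (r', a') * star (V.mat x' a') := by
  simp only [output, State.conj, Isom.idTensor, Matrix.mul_apply, Matrix.conjTranspose_apply,
    Matrix.kroneckerMap_apply, Fintype.sum_prod_type, Matrix.one_apply, ite_mul, one_mul, zero_mul,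
    apply_ite (star : ℂ → ℂ), star_zero, mul_ite, mul_zero]
  simp only [Finset.sum_ite_irrel, Finset.sum_const_zero, Finset.sum_ite_eq, Finset.mem_univ,
    if_true, Finset.sum_mul]
  exact Finset.sum_comm

theorem tracedB_symmetricErasure (ρ : State (R × A)) (g : A ⊕ Unit ≃ B) :
    (output ρ (symmetricErasure g)).tracedB = (output ρ (symmetricErasure g)).tracedE := by
  apply State.ext_mat
  ext ⟨r, b⟩ ⟨r', b'⟩
  change ∑ x, (output ρ (symmetricErasure g)).mat (r, (x, b)) (r', (x, b')) =
    ∑ x, (output ρ (symmetricErasure g)).mat (r, (b, x)) (r', (b', x))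
  simp only [output_apply, symmetricErasure_swap g _ b, symmetricErasure_swap g _ b']

/-- Cross terms vanish because `E` holds `e` in one branch and a vector orthogonal to it in the
other. If `E` holds `e`, `B` keeps the input; if `E` holds the input, tracing it out leaves ρ_R. -/
theorem tracedE_symmetricErasure_apply (ρ : State (R × A)) (g : A ⊕ Unit ≃ B) (r r' : R)
    (x x' : A ⊕ Unit) :
    (output ρ (symmetricErasure g)).tracedE.mat (r, g x) (r', g x') =
      ((1 / 2 : ℝ) : ℂ) * Matrix.fromBlocks (Matrix.of fun a a' => ρ.mat (r, a) (r', a'))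
        0 0 (Matrix.of fun _ _ => ρ.fst.mat r r') x x' := by
  have hs : ((√2)⁻¹ : ℂ) * ((√2)⁻¹ : ℂ) = ((1 / 2 : ℝ) : ℂ) := by
    rw [← mul_inv, ← Complex.ofReal_mul, Real.mul_self_sqrt (by norm_num)]
    norm_num
  have hs' : ∀ y : ℂ, ((√2)⁻¹ : ℂ) * y * ((√2)⁻¹ : ℂ) = ((1 / 2 : ℝ) : ℂ) * y := by
    intro y
    rw [← hs]
    ring
  change ∑ y, (output ρ (symmetricErasure g)).mat (r, (g x, y)) (r', (g x', y)) = _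
  rw [← Equiv.sum_comp g, Fintype.sum_sum_type]
  rcases x with a | u <;> rcases x' with a' | u' <;>
    simp [output_apply, symmetricErasure, State.fst, State.marginal, apply_ite (star : ℂ → ℂ),
      Finset.mul_sum, hs']

theorem infoB_symmetricErasure (ρ : State (R × A)) (g : A ⊕ Unit ≃ B) :
    infoB ρ (symmetricErasure g) = mutualInfo ρ / 2 := by
  set σ := (output ρ (symmetricErasure g)).tracedE with hσ
  have hfst : σ.fst = ρ.fst := by
    apply State.ext_mat
    ext r r'
    change ∑ b, σ.mat (r, b) (r', b) = ρ.fst.mat r r'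
    rw [← Equiv.sum_comp g, Fintype.sum_sum_type]
    simp only [hσ, tracedE_symmetricErasure_apply, Matrix.fromBlocks_apply₁₁,
      Matrix.fromBlocks_apply₂₂, Matrix.of_apply, ← Finset.mul_sum, Fintype.sum_unique]
    change ((1 / 2 : ℝ) : ℂ) * ρ.fst.mat r r' + _ = _
    push_cast
    ring
  -- `State.unit` is the flag block, pure and so of zero entropy.
  have hsnd : entropy σ.snd = 1 + (entropy ρ.snd + entropy State.unit) / 2 := by
    refine entropy_of_blocks σ.snd ρ.snd State.unit g ?_
    ext x x'
    change ∑ r, σ.mat (r, g x) (r, g x') = _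
    simp only [hσ, tracedE_symmetricErasure_apply, ← Finset.mul_sum]
    rcases x with a | u <;> rcases x' with a' | u'
    · rfl
    · simp
    · simp
    · change _ * ρ.fst.mat.trace = _ * _
      rw [ρ.fst.trace_eq_one]
      rfl
  have hjoint : entropy σ = 1 + (entropy ρ + entropy ρ.fst) / 2 := by
    refine entropy_of_blocks σ ρ ρ.fst
      (((Equiv.refl (R × A)).sumCongr (Equiv.prodPUnit R).symm).trans
        ((Equiv.prodSumDistrib R A Unit).symm.trans ((Equiv.refl R).prodCongr g))) ?_
    ext x x'
    rcases x with ⟨r, a⟩ | r <;> rcases x' with ⟨r', a'⟩ | r' 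
    · exact tracedE_symmetricErasure_apply ρ g r r' (.inl a) (.inl a')
    · exact (tracedE_symmetricErasure_apply ρ g r r' (.inl a) (.inr ())).trans (by simp)
    · exact (tracedE_symmetricErasure_apply ρ g r r' (.inr ()) (.inl a')).trans (by simp)
    · exact tracedE_symmetricErasure_apply ρ g r r' (.inr ()) (.inr ())
  rw [infoB, ← hσ, mutualInfo, mutualInfo, hfst, hsnd, hjoint, entropy_unit]
  ring

theorem infoE_symmetricErasure (ρ : State (R × A)) (g : A ⊕ Unit ≃ B) :
    infoE ρ (symmetricErasure g) = infoB ρ (symmetricErasure g) := by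
  rw [infoE, infoB, tracedB_symmetricErasure]

end PQD

theorem proposition2 {R A : Type*} [Fintype R] [Fintype A] [DecidableEq R] [DecidableEq A]
    (ρ : PQD.State (R × A)) :
    PQD.ineliminable ρ ⊤ ≤ ((PQD.mutualInfo ρ / 2 : ℝ) : EReal) ∧
      ∃ (dB dE : ℕ), ∃ V ∈ PQD.admissible ρ ⊤ dB dE, PQD.infoB ρ V ≤ PQD.mutualInfo ρ / 2 := by
  -- Both outputs have dimension dim A + 1, the extra one for the flag.
  let V := PQD.symmetricErasure (Fintype.equivFin (A ⊕ Unit))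
  have hV : V ∈ PQD.admissible ρ ⊤ _ _ :=
    ⟨by simp, (PQD.infoE_symmetricErasure ρ _).le⟩
  have hB : PQD.infoB ρ V = PQD.mutualInfo ρ / 2 := PQD.infoB_symmetricErasure ρ _
  refine ⟨?_, _, _, V, hV, hB.le⟩
  rw [← hB]
  exact (iInf_le _ _).trans ((iInf_le _ _).trans (iInf₂_le V hV))
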